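/- Let $\mathbb K$ be $\mathbb R$ or $\mathbb C$, and let $X$ be a sequence $F$-space over $\mathbb K$ indexed by $\mathbb Z$, that is, a topological vector space whose topology is induced by a complete translation-invariant metric, and which is continuously included in $\mathbb K^{\mathbb Z}$ (with the product topology). Suppose that the canonical unit vectors $(e_n)_{n\in\mathbb Z}$ belong to $X$ and form an unconditional basis of $X$, that is, every $x\in X$ has a unique expansion $x=\sum_{n\in\mathbb Z} a_n e_n$ with $a_n\in\mathbb K$, and this expansion converges unconditionally. Let $w=(w_n)_{n\in\mathbb Z}$ be a sequence of non-zero scalars such that $X$ is invariant under the bilateral weighted backward shift $B_w$ given by $(B_wx)_n=w_{n+1}x_{n+1}$ for $n\in\mathbb Z$, and let $T:X\to X$ be the restriction of $B_w$ to $X$. Suppose that $T$ is chaotic, that is, some $x\in X$ has a dense orbit $\{T^kx : k\ge 0\}$, and the set of periodic points of $T$ is dense in $X$. Then there exists a Borel probability measure $\mu$ on $X$ such that 1. $\mu$ is $T$-invariant: $T$ is Borel measurable and $\mu(T^{-1}(A))=\mu(A)$ for every Borel set $A\subset X$; 2. $T$ is strongly mixing with respect to $\mu$: $\lim_{k\to\infty}\mu(A\cap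 T^{-k}(B))=\mu(A)\mu(B)$ for all Borel sets $A,B\subset X$; 3. $\mu$ has full support: $\mu(U)>0$ for every non-empty open set $U\subset X$. -/

import Mathlib

open Filter Topology MeasureTheory Set

/-- An `F`-space over `𝕜`: a topological vector space whose topology is induced by a complete
translation-invariant metric. -/
structure IsFSpace (𝕜 X : Type*) [RCLike 𝕜] [AddCommGroup X] [Module 𝕜 X]
    [t : TopologicalSpace X] : Prop where
  isTopologicalAddGroup : IsTopologicalAddGroup X
  continuousSMul : ContinuousSMul 𝕜 X
  exists_metric : ∃ m : MetricSpace X,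
    m.toUniformSpace.toTopologicalSpace = t ∧
    @CompleteSpace X m.toUniformSpace ∧
    ∀ x y z : X, m.dist (x + z) (y + z) = m.dist x y

/-- A family is an unconditional basis if every vector has a unique expansion along the family
with scalar coefficients, and this expansion converges unconditionally
(`HasSum` is convergence of the net of all finite partial sums). -/
def IsUnconditionalBasis (𝕜 : Type*) {ι X : Type*} [RCLike 𝕜] [AddCommGroup X] [Module 𝕜 X]
    [TopologicalSpace X] (e : ι → X) : Prop :=
  ∀ x : X, ∃ a : ι → 𝕜, HasSum (fun i => a i • e i) x ∧
    ∀ b : ι → 𝕜, HasSum (fun i => b i • e i) x → b = a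

/-- The bilateral weighted backward shift on all two-sided scalar sequences:
`(B_w x)_n = w_{n+1} x_{n+1}`. -/
def bilateralShift {𝕜 : Type*} [RCLike 𝕜] (w : ℤ → 𝕜) (x : ℤ → 𝕜) : ℤ → 𝕜 :=
  fun n => w (n + 1) * x (n + 1)

/-- Let `X` be a sequence space, with inclusion `j` into the space of all two-sided sequences.
`T` is a bilateral weighted backward shift on `X` if it is the restriction to `X` of `B_w` for some
sequence `w` of non-zero weights (so that, in particular, `X` is invariant under `B_w`). -/
def IsBilateralWeightedShift {𝕜 X : Type*} [RCLike 𝕜] [AddCommGroup X] [Module 𝕜 X]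
    [TopologicalSpace X] (j : X →L[𝕜] (ℤ → 𝕜)) (T : X → X) : Prop :=
  ∃ w : ℤ → 𝕜, (∀ n, w n ≠ 0) ∧ ∀ x : X, j (T x) = bilateralShift w (j x)

/-- Some vector has a dense orbit `{x, T x, T² x, …}`. -/
def IsHypercyclic {X : Type*} [TopologicalSpace X] (T : X → X) : Prop :=
  ∃ x : X, Dense (range fun n : ℕ => T^[n] x)

/-- Devaney chaos for operators: hypercyclic with a dense set of periodic points. -/
def IsChaotic {X : Type*} [TopologicalSpace X] (T : X → X) : Prop :=
  IsHypercyclic T ∧ Dense (Function.periodicPts T)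

/-- `μ (A ∩ T⁻ⁿ B) → μ A * μ B` for all measurable sets `A`, `B`. -/
def IsStronglyMixing {X : Type*} [MeasurableSpace X] (T : X → X) (μ : Measure X) : Prop :=
  ∀ A B : Set X, MeasurableSet A → MeasurableSet B →
    Tendsto (fun n : ℕ => μ (A ∩ T^[n] ⁻¹' B)) atTop (𝓝 (μ A * μ B))

/-- Every non-empty open set has positive measure. -/
def HasFullSupport {X : Type*} [TopologicalSpace X] [MeasurableSpace X] (μ : Measure X) : Prop :=
  ∀ U : Set X, IsOpen U → U.Nonempty → 0 < μ U

/-!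
Chaos makes a series converge. Rescale the basis by `v = shiftScaling w`, so that `T` sends
`v n • e n` to `v (n - 1) • e (n - 1)`. Relative to the rescaled basis a periodic point of `T` has
periodic coordinates, and since periodic points are dense there is one whose coordinate at `0` does
not vanish. By unconditionality its subseries over the multiples of the period converges, and so do
the translates of that subseries; hence `∑ v n • e n` converges unconditionally
(`summable_shiftScaling_smul`).

This gives a random vector `∑ d (ω n) • v n • e n`, where `d` enumerates a dense sequence
of scalars and the `ω n` are independent with the same law on `ℕ`. For each `k`, the partial sums of
`∑ d k • v n • e n` outside some finite set `G k` have size at most `2⁻ᵏ`; if the law gives `k` a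
positive mass `p k` with `∑ #(G k) * p k < ∞`, then by Borel-Cantelli almost surely
`n ∈ G (ω n)` for only finitely many `n`, and the series converges (`summable_selection`). The
terms are grouped by the value of `ω n`, so only subseries of the fixed series `∑ d k • v n • e n`
are involved, and no local convexity is needed.

Applying `T` to the random vector amounts to shifting `ω`, so its law is `T`-invariant and strongly
mixing because Bernoulli shifts are (`isStronglyMixing_twoSidedShift`,
`IsStronglyMixing.comap_map`). It has full support because finitely many coordinates can be
prescribed while the rest of the series stays small, with positive probability
(`exists_finset_measure_selection_pos`, `exists_finset_norm_sum_selection_le`). The space is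
separable and completely metrizable, so the coordinate map `j` is a Borel embedding; measurability
is always checked in coordinates.
-/

/-! ### Strong mixing of Bernoulli shifts -/

/-- Setwise convergence of measures propagates from a generating π-system to all measurable sets,
as soon as the sequence is dominated by a single finite measure (which supplies the domination
needed for countable disjoint unions). -/
theorem tendsto_measure_of_generating_piSystem {α : Type*} {m : MeasurableSpace α}
    {μ ρ : Measure α} [IsFiniteMeasure μ] {ρs : ℕ → Measure α} {C : Set (Set α)}
    (hgen : m = MeasurableSpace.generateFrom C) (hpi : IsPiSystem C)
    (hle : ∀ n s, MeasurableSet s → ρs n s ≤ μ s)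
    (huniv : Tendsto (fun n => ρs n univ) atTop (𝓝 (ρ univ)))
    (hC : ∀ s ∈ C, Tendsto (fun n => ρs n s) atTop (𝓝 (ρ s)))
    {s : Set α} (hs : MeasurableSet s) :
    Tendsto (fun n => ρs n s) atTop (𝓝 (ρ s)) := by
  have hfin : ∀ n, IsFiniteMeasure (ρs n) := fun n =>
    ⟨(hle n _ .univ).trans_lt (measure_lt_top μ _)⟩
  have hρ : IsFiniteMeasure ρ :=
    ⟨(le_of_tendsto' huniv fun n => hle n _ .univ).trans_lt (measure_lt_top μ _)⟩
  induction s, hs using MeasurableSpace.induction_on_inter hgen hpi with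
  | empty => simp
  | basic t ht => exact hC t ht
  | compl t htm ih =>
    simp only [measure_compl htm (measure_ne_top _ _)]
    exact ENNReal.Tendsto.sub huniv ih (.inl (measure_ne_top _ _))
  | iUnion f hd hfm ih =>
    simp only [measure_iUnion hd hfm, ← lintegral_count]
    refine tendsto_lintegral_of_dominated_convergence (fun i => μ (f i))
      (fun n => measurable_of_countable _) (fun n => ae_of_all _ fun i => hle n _ (hfm i)) ?_
      (ae_of_all _ ih)
    rw [lintegral_count, ← measure_iUnion hd hfm]
    exact measure_ne_top _ _

/-- It is enough to check strong mixing of a measure-preserving map on a generating π-system. -/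
theorem isStronglyMixing_of_generating_piSystem {α : Type*} {m : MeasurableSpace α}
    {μ : Measure α} [IsProbabilityMeasure μ] {T : α → α} (hT : MeasurePreserving T μ μ)
    {C : Set (Set α)} (hgen : m = MeasurableSpace.generateFrom C) (hpi : IsPiSystem C)
    (hC : ∀ A ∈ C, ∀ B ∈ C, Tendsto (fun n : ℕ => μ (A ∩ T^[n] ⁻¹' B)) atTop (𝓝 (μ A * μ B))) :
    IsStronglyMixing T μ := by
  have hCm : ∀ A ∈ C, MeasurableSet A := fun A hA => hgen ▸ .basic A hA
  have hTn : ∀ n, Measurable T^[n] := fun n => (hT.iterate n).measurable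
  -- first extend in `A`, for a fixed `B` in the π-system
  have step : ∀ A, MeasurableSet A → ∀ B ∈ C,
      Tendsto (fun n : ℕ => μ (A ∩ T^[n] ⁻¹' B)) atTop (𝓝 (μ A * μ B)) := by
    intro A hA B hB
    have key := tendsto_measure_of_generating_piSystem (μ := μ) (ρ := μ B • μ)
      (ρs := fun n => μ.restrict (T^[n] ⁻¹' B)) hgen hpi
      (fun n s _ => Measure.restrict_apply_le _ _) ?_ ?_ hA
    · simpa [Measure.restrict_apply hA, mul_comm] using key
    · simp [(hT.iterate _).measure_preimage (hCm B hB).nullMeasurableSet]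
    · intro s hs
      simpa [Measure.restrict_apply (hCm s hs), mul_comm] using hC s hs B hB
  -- then in `B`, for a fixed measurable `A`
  intro A B hA hB
  have hap : ∀ n s, MeasurableSet s →
      (μ.restrict A).map T^[n] s = μ (A ∩ T^[n] ⁻¹' s) := fun n s hs => by
    rw [Measure.map_apply (hTn n) hs, Measure.restrict_apply (hTn n hs), inter_comm]
  have key := tendsto_measure_of_generating_piSystem (μ := μ) (ρ := μ A • μ)
    (ρs := fun n => (μ.restrict A).map T^[n]) hgen hpi ?_ ?_ ?_ hB
  · simpa [hap _ B hB] using key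
  · intro n s hs
    rw [hap n s hs, ← (hT.iterate n).measure_preimage hs.nullMeasurableSet]
    exact measure_mono inter_subset_right
  · simp [hap _ _ MeasurableSet.univ]
  · intro s hs
    simpa [hap _ s (hCm s hs)] using step A hA s hs

/-- The left shift on two-sided sequences. -/
def twoSidedShift {α : Type*} (ω : ℤ → α) : ℤ → α := fun n => ω (n + 1)

theorem twoSidedShift_iterate_apply {α : Type*} (k : ℕ) (ω : ℤ → α) (n : ℤ) :
    twoSidedShift^[k] ω n = ω (n + k) := by
  induction k generalizing n with
  | zero => simp
  | succ k ih =>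
    rw [Function.iterate_succ_apply', twoSidedShift, ih]
    congr 1
    push_cast
    ring

theorem twoSidedShift_iterate_preimage_pi {α : Type*} (k : ℕ) (s : Finset ℤ) (t : ℤ → Set α) :
    twoSidedShift^[k] ⁻¹' (s : Set ℤ).pi t =
      ((s.map (addRightEmbedding (k : ℤ)) : Finset ℤ) : Set ℤ).pi fun n => t (n - k) := by
  ext ω
  simp only [mem_preimage, Set.mem_pi, twoSidedShift_iterate_apply, Finset.mem_coe,
    Finset.forall_mem_map, addRightEmbedding_apply, add_sub_cancel_right]

theorem measurePreserving_twoSidedShift {α : Type*} [MeasurableSpace α] (ν : Measure α)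
    [IsProbabilityMeasure ν] :
    MeasurePreserving twoSidedShift (Measure.infinitePi fun _ : ℤ => ν)
      (Measure.infinitePi fun _ : ℤ => ν) := by
  have hm : Measurable (twoSidedShift (α := α)) :=
    measurable_pi_lambda _ fun n => measurable_pi_apply (n + 1)
  refine ⟨hm, Measure.eq_infinitePi _ fun s t ht => ?_⟩
  rw [Measure.map_apply hm (.pi s.countable_toSet fun i _ => ht i)]
  have := twoSidedShift_iterate_preimage_pi 1 s t
  rw [Function.iterate_one] at this
  rw [this, Measure.infinitePi_pi _ fun i _ => ht _]
  simp

/-- For cylinders the correlation is eventually equal to the product: once the shift has moved the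
coordinates of the second cylinder away from those of the first, the two are independent. -/
theorem isStronglyMixing_twoSidedShift {α : Type*} [MeasurableSpace α] (ν : Measure α)
    [IsProbabilityMeasure ν] :
    IsStronglyMixing twoSidedShift (Measure.infinitePi fun _ : ℤ => ν) := by
  refine isStronglyMixing_of_generating_piSystem (measurePreserving_twoSidedShift ν)
    generateFrom_squareCylinders.symm
    (isPiSystem_squareCylinders (fun _ => MeasurableSpace.isPiSystem_measurableSet) (by simp)) ?_
  rintro _ ⟨s, t, ht, rfl⟩ _ ⟨s', t', ht', rfl⟩
  simp only [mem_univ_pi, mem_ofPred_eq] at ht ht'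
  obtain ⟨a, ha⟩ := s.bddAbove
  obtain ⟨b, hb⟩ := s'.bddBelow
  refine tendsto_const_nhds.congr' ?_
  filter_upwards [eventually_gt_atTop (a - b).toNat] with k hk
  have hdisj : Disjoint s (s'.map (addRightEmbedding (k : ℤ))) := by
    rw [Finset.disjoint_left]
    intro n hn hn'
    obtain ⟨i, hi, rfl⟩ := Finset.mem_map.1 hn'
    have h1 := ha hn
    have h2 := hb hi
    simp only [addRightEmbedding_apply] at h1
    omega
  -- the intersection is again a cylinder, over a disjoint union of coordinates
  have hinter : (s : Set ℤ).pi t ∩ twoSidedShift^[k] ⁻¹' (s' : Set ℤ).pi t' =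
      ((s.disjUnion _ hdisj : Finset ℤ) : Set ℤ).pi
        (fun n => if n ∈ s then t n else t' (n - k)) := by
    rw [twoSidedShift_iterate_preimage_pi, Finset.coe_disjUnion, union_pi]
    congr 1
    · exact pi_congr rfl fun n hn => by simp [Finset.mem_coe.1 hn]
    · exact pi_congr rfl fun n hn => by
        simp [Finset.disjoint_right.1 hdisj (Finset.mem_coe.1 hn)]
  rw [hinter, Measure.infinitePi_pi, Measure.infinitePi_pi, Measure.infinitePi_pi,
    Finset.prod_disjUnion]
  · congr 1
    · exact Finset.prod_congr rfl fun n hn => by simp [hn]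
    · rw [Finset.prod_map]
      refine Finset.prod_congr rfl fun n hn => ?_
      have : n + (k : ℤ) ∉ s :=
        Finset.disjoint_right.1 hdisj (Finset.mem_map.2 ⟨n, hn, rfl⟩)
      simp only [addRightEmbedding_apply, if_neg this]
      exact congrArg (fun m => ν (t' m)) (add_sub_cancel_right n (k : ℤ)).symm
  · intro i _
    split_ifs
    exacts [ht i, ht' _]
  · exact fun i _ => ht' i
  · exact fun i _ => ht i

/-! ### Random series along a summable family -/

section RandomSeries

variable {X : Type*} [NormedAddCommGroup X]

/-- Suppose that, for every `k`, the partial sums of the family `g k` outside the finite set `G k`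
have size at most `2⁻ᵏ`, and that each `g k` is summable. Then the partial sums of
`n ↦ g (ω n) n` outside a large finite set are small, uniformly in all sequences `ω` of indices that
satisfy `n ∉ G (ω n)` there: group the terms according to the value of `ω`; large values contribute
little by the choice of `G`, the finitely many other ones by summability. -/
theorem exists_finset_norm_sum_selection_le [CompleteSpace X] {ι : Type*} [DecidableEq ι]
    {g : ℕ → ι → X} (hg : ∀ k, Summable (g k)) {G : ℕ → Finset ι}
    (hG : ∀ k F, Disjoint F (G k) → ‖∑ n ∈ F, g k n‖ < (1 / 2) ^ k) {ε : ℝ} (hε : 0 < ε) :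
    ∃ H : Finset ι, ∀ (ω : ι → ℕ) (F : Finset ι), Disjoint F H → (∀ n ∈ F, n ∉ G (ω n)) →
      ‖∑ n ∈ F, g (ω n) n‖ < ε := by
  obtain ⟨S, hS⟩ := summable_iff_vanishing_norm.1 summable_geometric_two (ε / 2) (half_pos hε)
  set δ : ℝ := ε / (2 * (S.card + 1)) with hδ
  have hδpos : 0 < δ := by positivity
  choose H hH using fun k => summable_iff_vanishing_norm.1 (hg k) δ hδpos
  refine ⟨S.biUnion H, fun ω F hF hω => ?_⟩
  set a : ℕ → ℝ := fun k => ‖∑ n ∈ F with ω n = k, g k n‖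
  have hfib : ‖∑ n ∈ F, g (ω n) n‖ ≤ ∑ k ∈ F.image ω, a k := by
    rw [← Finset.sum_fiberwise_of_maps_to (fun n hn => Finset.mem_image_of_mem ω hn)]
    refine (norm_sum_le _ _).trans (le_of_eq (Finset.sum_congr rfl fun k _ => ?_))
    refine congrArg norm (Finset.sum_congr rfl fun n hn => ?_)
    rw [(Finset.mem_filter.1 hn).2]
  have hlarge : ∀ k, a k ≤ (1 / 2) ^ k := fun k => by
    refine (hG k _ (Finset.disjoint_left.2 fun n hn => ?_)).le
    obtain ⟨hnF, rfl⟩ := Finset.mem_filter.1 hn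
    exact hω n hnF
  have hsmall : ∀ k ∈ S, a k ≤ δ := fun k hk =>
    (hH k _ (Finset.disjoint_of_subset_left (Finset.filter_subset _ _)
      (Finset.disjoint_of_subset_right (Finset.subset_biUnion_of_mem H hk) hF))).le
  have h1 : ∑ k ∈ F.image ω with k ∈ S, a k ≤ S.card * δ := by
    calc ∑ k ∈ F.image ω with k ∈ S, a k ≤ ∑ k ∈ S, a k :=
          Finset.sum_le_sum_of_subset_of_nonneg
            (fun k hk => (Finset.mem_filter.1 hk).2) fun _ _ _ => norm_nonneg _
      _ ≤ S.card * δ := by simpa using Finset.sum_le_card_nsmul S a δ hsmall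
  have h2 : ∑ k ∈ F.image ω with k ∉ S, a k < ε / 2 := by
    calc ∑ k ∈ F.image ω with k ∉ S, a k
        ≤ ∑ k ∈ F.image ω with k ∉ S, ((1 : ℝ) / 2) ^ k := Finset.sum_le_sum fun k _ => hlarge k
      _ ≤ ‖∑ k ∈ F.image ω with k ∉ S, ((1 : ℝ) / 2) ^ k‖ := Real.le_norm_self _
      _ < ε / 2 := hS _ (Finset.disjoint_left.2 fun k hk => (Finset.mem_filter.1 hk).2)
  have h3 : S.card * δ ≤ ε / 2 := by
    rw [hδ, mul_div_assoc', div_le_div_iff₀ (by positivity) (by positivity)]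
    nlinarith
  rw [← Finset.sum_filter_add_sum_filter_not (F.image ω) (· ∈ S)] at hfib
  linarith

/-- A selection `n ↦ g (ω n) n` with `n ∉ G (ω n)` for all but finitely many `n` is summable. -/
theorem summable_selection [CompleteSpace X] {ι : Type*}
    {g : ℕ → ι → X} (hg : ∀ k, Summable (g k)) {G : ℕ → Finset ι}
    (hG : ∀ k F, Disjoint F (G k) → ‖∑ n ∈ F, g k n‖ < (1 / 2) ^ k)
    {ω : ι → ℕ} (hω : {n | n ∈ G (ω n)}.Finite) :
    Summable fun n => g (ω n) n := by
  classical
  refine summable_iff_vanishing_norm.2 fun ε hε => ?_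
  obtain ⟨H, hH⟩ := exists_finset_norm_sum_selection_le hg hG hε
  refine ⟨H ∪ hω.toFinset, fun F hF => ?_⟩
  rw [Finset.disjoint_union_right] at hF
  exact hH ω F hF.1 fun n hn hn' => Finset.disjoint_left.1 hF.2 hn (hω.mem_toFinset.2 hn')

/-- If all partial sums avoiding the finite set `Q` are bounded by `ε`, then the sum is within `ε`
of the partial sum over `Q`. -/
theorem norm_sub_sum_le_of_hasSum {ι : Type*} [DecidableEq ι] {f : ι → X} {z : X} (hf : HasSum f z)
    {Q : Finset ι} {ε : ℝ} (h : ∀ F, Disjoint F Q → ‖∑ n ∈ F, f n‖ ≤ ε) :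
    ‖z - ∑ n ∈ Q, f n‖ ≤ ε := by
  refine le_of_tendsto ((hf.sub_const (∑ n ∈ Q, f n)).norm) ?_
  filter_upwards [eventually_ge_atTop Q] with F hF
  rw [← Finset.sum_sdiff hF, add_sub_cancel_right]
  exact h _ Finset.sdiff_disjoint

end RandomSeries

/-- There are probability distributions on `ℕ` that charge every point and decay faster than any
prescribed rate. -/
theorem exists_pmf_tsum_mul_ne_top (c : ℕ → ℕ) :
    ∃ p : PMF ℕ, (∀ k, p k ≠ 0) ∧ ∑' k, c k * p k ≠ ⊤ := by
  set q : ℕ → ENNReal := fun k => 2⁻¹ ^ k * ((c k : ENNReal) + 1)⁻¹ with hq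
  have hq0 : ∀ k, q k ≠ 0 := fun k =>
    mul_ne_zero (pow_ne_zero _ (by simp)) (ENNReal.inv_ne_zero.2 (by simp))
  have hle : ∀ k, ((c k : ENNReal) + 1) * q k = 2⁻¹ ^ k := fun k => by
    rw [hq]
    dsimp only
    rw [mul_left_comm, ENNReal.mul_inv_cancel (by simp) (by simp), mul_one]
  have hgeom : ∑' k : ℕ, (2⁻¹ : ENNReal) ^ k ≠ ⊤ := by
    rw [ENNReal.tsum_geometric]; simp
  have hsum : ∑' k, q k ≠ ⊤ := ne_top_of_le_ne_top hgeom <| ENNReal.tsum_le_tsum fun k => by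
    rw [← hle k]
    exact le_mul_of_one_le_left' le_add_self
  have hsum0 : ∑' k, q k ≠ 0 := fun h => hq0 0 (ENNReal.tsum_eq_zero.1 h 0)
  refine ⟨PMF.normalize q hsum0 hsum, fun k => ?_, ?_⟩
  · exact mul_ne_zero (hq0 k) (ENNReal.inv_ne_zero.2 hsum)
  · have : ∑' k, (c k : ENNReal) * q k ≠ ⊤ :=
      ne_top_of_le_ne_top hgeom <| ENNReal.tsum_le_tsum fun k => by
        rw [← hle k]
        gcongr
        exact le_self_add
    simp only [PMF.normalize_apply, ← mul_assoc, ENNReal.tsum_mul_right]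
    exact ENNReal.mul_ne_top this (ENNReal.inv_ne_top.2 hsum0)

/-! ### Independent coordinates avoiding finite sets of indices -/

section Avoiding

variable {p : PMF ℕ} {G : ℕ → Finset ℤ}

/-- By Borel-Cantelli, almost surely `n ∈ G (ω n)` for only finitely many `n`. -/
theorem ae_finite_mem_selection (hp : ∑' k, ((G k).card : ENNReal) * p k ≠ ⊤) :
    ∀ᵐ ω ∂(Measure.infinitePi fun _ : ℤ => p.toMeasure), {n | n ∈ G (ω n)}.Finite := by
  have hbound : ∀ k, (Measure.infinitePi fun _ : ℤ => p.toMeasure) {ω | ∃ n ∈ G k, ω n = k} ≤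
      (G k).card * p k := fun k => by
    have hset : {ω : ℤ → ℕ | ∃ n ∈ G k, ω n = k} = ⋃ n ∈ G k, {ω | ω n = k} := by
      ext; simp
    rw [hset]
    refine (measure_biUnion_finset_le _ _).trans ?_
    rw [← nsmul_eq_mul]
    refine Finset.sum_le_card_nsmul _ _ _ fun n _ => le_of_eq ?_
    have := (measurePreserving_eval_infinitePi (fun _ : ℤ => p.toMeasure) n).measure_preimage
      (measurableSet_singleton k).nullMeasurableSet
    rw [PMF.toMeasure_apply_singleton _ _ (measurableSet_singleton k)] at this
    exact this
  filter_upwards [ae_finite_setOfPred_mem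
    (ne_top_of_le_ne_top hp (ENNReal.tsum_le_tsum hbound))] with ω hω
  refine (hω.biUnion fun k _ => (G k).finite_toSet).subset fun n hn => ?_
  exact mem_biUnion (x := ω n) ⟨n, hn, rfl⟩ hn

/-- Outside a large finite set `Q`, the condition `n ∉ G (ω n)` can be imposed on all coordinates
together with any prescribed values on `Q`, with positive probability. -/
theorem exists_finset_measure_selection_pos (hp0 : ∀ k, p k ≠ 0)
    (hp : ∑' k, ((G k).card : ENNReal) * p k ≠ ⊤) :
    ∃ Q₀ : Finset ℤ, ∀ Q, Q₀ ⊆ Q → ∀ c : ℤ → ℕ,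
      0 < (Measure.infinitePi fun _ : ℤ => p.toMeasure)
        {ω | (∀ n ∈ Q, ω n = c n) ∧ ∀ n, n ∉ Q → n ∉ G (ω n)} := by
  set P := Measure.infinitePi fun _ : ℤ => p.toMeasure
  have hsing : ∀ k, p.toMeasure {k} = p k := fun k =>
    PMF.toMeasure_apply_singleton _ _ (measurableSet_singleton k)
  obtain ⟨K, hK⟩ := ((ENNReal.tendsto_sum_nat_add _ hp).eventually_lt_const
    (zero_lt_one)).exists
  refine ⟨(Finset.range K).biUnion G, fun Q hQ c => ?_⟩
  set A : Set (ℤ → ℕ) := (Q : Set ℤ).pi fun n => {c n}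
  have hA : P A ≠ 0 := by
    rw [Measure.infinitePi_pi _ fun i _ => measurableSet_singleton _]
    exact Finset.prod_ne_zero_iff.2 fun n _ => by rw [hsing]; exact hp0 _
  -- values below `K` cannot violate the condition, and a violation outside `Q` is independent of `A`
  have hbad : ∀ k, P (⋃ n ∈ G (k + K) \ Q, A ∩ {ω | ω n = k + K}) ≤
      P A * ((G (k + K)).card * p (k + K)) := fun k => by
    refine (measure_biUnion_finset_le _ _).trans ?_
    calc ∑ n ∈ G (k + K) \ Q, P (A ∩ {ω | ω n = k + K})
        ≤ (G (k + K) \ Q).card • (P A * p (k + K)) :=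
          Finset.sum_le_card_nsmul _ _ _ fun n hn => le_of_eq ?_
      _ ≤ (G (k + K)).card • (P A * p (k + K)) := by
          gcongr
          exact Finset.sdiff_subset
      _ = P A * ((G (k + K)).card * p (k + K)) := by rw [nsmul_eq_mul]; ring
    have hnQ : n ∉ Q := (Finset.mem_sdiff.1 hn).2
    have hset : A ∩ {ω | ω n = k + K} =
        ((insert n Q : Finset ℤ) : Set ℤ).pi fun i => {Function.update c n (k + K) i} := by
      ext ω
      simp only [A, mem_inter_iff, Set.mem_pi, Finset.coe_insert, mem_insert_iff,
        forall_eq_or_imp, Finset.mem_coe, mem_singleton_iff, Function.update_self, mem_ofPred_eq]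
      rw [and_comm]
      refine and_congr_right fun _ => forall₂_congr fun i hi => ?_
      rw [Function.update_of_ne (ne_of_mem_of_not_mem hi hnQ)]
    rw [hset, Measure.infinitePi_pi _ fun i _ => measurableSet_singleton _,
      Finset.prod_insert hnQ, Measure.infinitePi_pi _ fun i _ => measurableSet_singleton _,
      Function.update_self, hsing, mul_comm]
    congr 1
    refine Finset.prod_congr rfl fun i hi => ?_
    rw [Function.update_of_ne (ne_of_mem_of_not_mem hi hnQ)]
  have hbad' : P (⋃ k, ⋃ n ∈ G (k + K) \ Q, A ∩ {ω | ω n = k + K}) < P A := by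
    refine (measure_iUnion_le _).trans_lt ((ENNReal.tsum_le_tsum hbad).trans_lt ?_)
    rw [ENNReal.tsum_mul_left]
    calc _ < P A * 1 := ENNReal.mul_lt_mul_right hA (measure_ne_top _ _) hK
      _ = P A := mul_one _
  refine (tsub_pos_of_lt hbad').trans_le (le_measure_sdiff.trans (measure_mono ?_))
  rintro ω ⟨hωA, hω⟩
  refine ⟨fun n hn => hωA n hn, fun n hn hmem => hω ?_⟩
  have hKω : K ≤ ω n := by
    by_contra! hlt
    exact hn (hQ (Finset.mem_biUnion.2 ⟨ω n, Finset.mem_range.2 hlt, hmem⟩))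
  obtain ⟨k, hk⟩ := Nat.exists_eq_add_of_le' hKω
  simp only [mem_iUnion]
  exact ⟨k, n, Finset.mem_sdiff.2 ⟨hk ▸ hmem, hn⟩, hωA, hk⟩

end Avoiding

/-! ### Coordinates and chaotic weighted shifts -/

/-- A solution of `w (n + 1) * v (n + 1) = v n` with `v 0 = 1`. The vectors `v n • e n` are permuted
by the weighted shift: `v n • e n` is sent to `v (n - 1) • e (n - 1)`. -/
noncomputable def shiftScaling {𝕜 : Type*} [Field 𝕜] (w : ℤ → 𝕜) : ℤ → 𝕜
  | Int.ofNat n => ∏ i ∈ Finset.range n, (w (i + 1))⁻¹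
  | Int.negSucc n => ∏ i ∈ Finset.range (n + 1), w (-i)

theorem shiftScaling_ne_zero {𝕜 : Type*} [Field 𝕜] {w : ℤ → 𝕜} (hw : ∀ n, w n ≠ 0) (n : ℤ) :
    shiftScaling w n ≠ 0 := by
  cases n with
  | ofNat n => exact Finset.prod_ne_zero_iff.2 fun i _ => inv_ne_zero (hw _)
  | negSucc n => exact Finset.prod_ne_zero_iff.2 fun i _ => hw _

theorem mul_shiftScaling_succ {𝕜 : Type*} [Field 𝕜] {w : ℤ → 𝕜} (hw : ∀ n, w n ≠ 0) (n : ℤ) :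
    w (n + 1) * shiftScaling w (n + 1) = shiftScaling w n := by
  cases n with
  | ofNat n =>
    have h : (Int.ofNat n + 1 : ℤ) = Int.ofNat (n + 1) := rfl
    rw [h]
    simp only [shiftScaling]
    rw [Finset.prod_range_succ, mul_left_comm]
    simp [hw]
  | negSucc n =>
    cases n with
    | zero =>
      have h : (Int.negSucc 0 + 1 : ℤ) = Int.ofNat 0 := rfl
      rw [h]
      simp [shiftScaling]
    | succ n =>
      have h : (Int.negSucc (n + 1) + 1 : ℤ) = Int.negSucc n := rfl
      rw [h]
      simp only [shiftScaling]
      rw [Finset.prod_range_succ _ (n + 1), mul_comm]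
      congr 2

section Coordinates

variable {𝕜 X : Type*} [RCLike 𝕜] [NormedAddCommGroup X] [Module 𝕜 X]
  {j : X →L[𝕜] (ℤ → 𝕜)} {e : ℤ → X}

theorem coordinates_eq_of_hasSum (he : ∀ n, j (e n) = Pi.single n 1) {a : ℤ → 𝕜} {x : X}
    (h : HasSum (fun n => a n • e n) x) : j x = a := by
  funext m
  have h1 : HasSum (fun n => j (a n • e n) m) (j x m) :=
    Pi.hasSum.1 (h.mapL j) m
  refine h1.unique ?_
  convert hasSum_single m fun n hn => ?_ using 1
  · simp [he]
  · simp [he, hn.symm]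

theorem hasSum_coordinates (he : ∀ n, j (e n) = Pi.single n 1)
    (hbasis : IsUnconditionalBasis 𝕜 e) (x : X) : HasSum (fun n => j x n • e n) x := by
  obtain ⟨a, ha, -⟩ := hbasis x
  rwa [coordinates_eq_of_hasSum he ha]

/-- Relative to the family `shiftScaling w n • e n`, the weighted shift is the unweighted one. -/
theorem coordinates_iterate {w : ℤ → 𝕜} (hw : ∀ n, w n ≠ 0) {T : X → X}
    (hT : ∀ x, j (T x) = bilateralShift w (j x)) (k : ℕ) (x : X) (n : ℤ) :
    j (T^[k] x) n / shiftScaling w n = j x (n + k) / shiftScaling w (n + k) := by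
  induction k generalizing n with
  | zero => simp
  | succ k ih =>
    rw [Function.iterate_succ_apply', hT, bilateralShift, ← mul_shiftScaling_succ hw n,
      mul_div_mul_left _ _ (hw _), ih]
    push_cast
    rw [add_assoc, add_comm (1 : ℤ)]

/-- A periodic point of period `N` with non-zero coordinate at `0` has, relative to the family
`v n • e n`, coordinates that are periodic in `n`; unconditionality allows to keep only those at
multiples of `N`, so that `∑ v (k * N) • e (k * N)` converges, and applying the iterates of the shift
to the sum gives the same along all residue classes modulo `N`. -/
theorem summable_shiftScaling_smul [CompleteSpace X] [ContinuousSMul 𝕜 X]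
    (he : ∀ n, j (e n) = Pi.single n 1) (hbasis : IsUnconditionalBasis 𝕜 e)
    {w : ℤ → 𝕜} (hw : ∀ n, w n ≠ 0) {T : X → X} (hT : ∀ x, j (T x) = bilateralShift w (j x))
    (hper : Dense (Function.periodicPts T)) :
    Summable fun n => shiftScaling w n • e n := by
  set v := shiftScaling w with hv
  have hv0 : ∀ n, v n ≠ 0 := shiftScaling_ne_zero hw
  obtain ⟨x, hx0, N, hN, hxN⟩ : ∃ x, j x 0 ≠ 0 ∧ ∃ N > 0, Function.IsPeriodicPt T N x := by
    have hopen : IsOpen {x | j x 0 ≠ 0} :=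
      isOpen_ne.preimage ((continuous_apply 0).comp j.continuous)
    obtain ⟨x, hx, hxp⟩ := hper.inter_open_nonempty _ hopen ⟨e 0, by simp [he]⟩
    exact ⟨x, hx, hxp⟩
  have hmul : ∀ k : ℕ, ∀ n : ℤ, j x (n + k * N) / v (n + k * N) = j x n / v n := fun k n => by
    have h := coordinates_iterate hw hT (k * N) x n
    rw [(hxN.const_mul k).eq] at h
    push_cast at h
    exact h.symm
  have hdvd : ∀ n : ℤ, (N : ℤ) ∣ n → j x n / v n = j x 0 / v 0 := by
    rintro _ ⟨k, rfl⟩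
    obtain ⟨k, rfl | rfl⟩ := k.eq_nat_or_neg
    · simpa [mul_comm] using hmul k 0
    · simpa [mul_comm] using (hmul k (-(k * N))).symm
  set b : 𝕜 := j x 0 / v 0
  have hb : b ≠ 0 := div_ne_zero hx0 (hv0 0)
  -- the subseries over the multiples of `N`
  have hsub : Summable fun n : ℤ => (if (N : ℤ) ∣ n then v n else 0) • e n := by
    have h := ((hasSum_coordinates he hbasis x).summable.indicator {n : ℤ | (N : ℤ) ∣ n}).const_smul
      b⁻¹
    refine h.congr fun n => ?_
    by_cases hn : (N : ℤ) ∣ n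
    · have : b⁻¹ * j x n = v n := by
        rw [(div_eq_iff (hv0 n)).1 (hdvd n hn), inv_mul_cancel_left₀ hb]
      simp [hn, indicator, smul_smul, this]
    · simp [hn, indicator]
  obtain ⟨y, hy⟩ := hsub
  have hjy := coordinates_eq_of_hasSum he hy
  -- its translates, by expanding `T^[i] y` along the basis; continuity of `T` plays no role
  have htrans : ∀ i : ℕ, Summable fun n : ℤ => (if (N : ℤ) ∣ n + i then v n else 0) • e n := by
    intro i
    refine (hasSum_coordinates he hbasis (T^[i] y)).summable.congr fun n => ?_
    have h := coordinates_iterate hw hT i y n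
    rw [hjy, div_eq_iff (hv0 n)] at h
    rw [h, ← hv]
    congr 1
    by_cases hn : (N : ℤ) ∣ n + i
    · simp [hn, hv0]
    · simp [hn]
  refine (summable_sum (s := Finset.range N) fun i _ => htrans i).congr fun n => ?_
  rw [← Finset.sum_smul]
  congr 1
  -- exactly one residue `i < N` satisfies `N ∣ n + i`
  have hN' : (0 : ℤ) < N := by exact_mod_cast hN
  have hr0 := Int.emod_nonneg (-n) hN'.ne'
  have hr := Int.emod_lt_of_pos (-n) hN'
  rw [Finset.sum_eq_single ((-n) % N).toNat]
  · rw [if_pos]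
    rw [Int.toNat_of_nonneg hr0, Int.emod_def]
    exact ⟨-(-n / N), by ring⟩
  · intro i hi hne
    rw [if_neg]
    rintro ⟨k, hk⟩
    refine hne ?_
    have : (-n) % N = i := by
      have h1 : -n = i + N * (-k) := by rw [mul_neg, ← hk]; ring
      rw [h1, Int.add_mul_emod_self_left]
      exact Int.emod_eq_of_lt (by positivity) (by exact_mod_cast Finset.mem_range.1 hi)
    omega
  · intro h
    refine absurd (Finset.mem_range.2 ?_) h
    omega

theorem separableSpace_of_isUnconditionalBasis [ContinuousSMul 𝕜 X]
    (hbasis : IsUnconditionalBasis 𝕜 e) : TopologicalSpace.SeparableSpace X := by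
  have hsep : TopologicalSpace.IsSeparable (Submodule.span 𝕜 (range e) : Set X) :=
    (countable_range e).isSeparable.span
  rw [← TopologicalSpace.isSeparable_univ_iff]
  refine hsep.closure.mono fun x _ => ?_
  obtain ⟨a, ha, -⟩ := hbasis x
  refine mem_closure_of_tendsto ha (Eventually.of_forall fun F => ?_)
  exact Submodule.sum_mem _ fun n _ =>
    Submodule.smul_mem _ _ (Submodule.subset_span (mem_range_self n))

end Coordinates

/-! ### The invariant measure -/

/-- Let a measure-preserving strongly mixing system be mapped by `φ`, equivariantly, into a space in
which `T` is embedded by `j`, almost surely into the range of `j`. Then the image measure, read in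
the domain of `j`, is a strongly mixing `T`-invariant measure. -/
theorem IsStronglyMixing.comap_map {Ω Y X : Type*} [MeasurableSpace Ω] [MeasurableSpace Y]
    [MeasurableSpace X] {P : Measure Ω} [IsProbabilityMeasure P] {σ : Ω → Ω}
    (hσ : MeasurePreserving σ P P) (hmix : IsStronglyMixing σ P) {φ : Ω → Y} (hφ : Measurable φ)
    {S : Y → Y} (hS : Measurable S) (hφσ : ∀ ω, φ (σ ω) = S (φ ω))
    {j : X → Y} (hj : MeasurableEmbedding j) {T : X → X} (hT : ∀ x, j (T x) = S (j x))
    (hrange : ∀ᵐ ω ∂P, φ ω ∈ range j) :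
    IsProbabilityMeasure ((P.map φ).comap j) ∧
      MeasurePreserving T ((P.map φ).comap j) ((P.map φ).comap j) ∧
      IsStronglyMixing T ((P.map φ).comap j) := by
  have happ : ∀ A, MeasurableSet A → (P.map φ).comap j A = P (φ ⁻¹' (j '' A)) := fun A hA => by
    rw [hj.comap_apply, Measure.map_apply hφ (hj.measurableSet_image.2 hA)]
  have hTm : Measurable T := hj.measurable_comp_iff.1 <| by
    have : j ∘ T = S ∘ j := funext hT
    rw [this]
    exact hS.comp hj.measurable
  have hTk : ∀ k x, j (T^[k] x) = S^[k] (j x) := fun k x =>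
    (Function.Semiconj.iterate_right hT k) x
  have hφk : ∀ k ω, φ (σ^[k] ω) = S^[k] (φ ω) := fun k ω =>
    (Function.Semiconj.iterate_right hφσ k) ω
  have hmem : ∀ k ω x, j x = φ ω → ∀ B : Set X, T^[k] x ∈ B ↔ σ^[k] ω ∈ φ ⁻¹' (j '' B) := by
    intro k ω x hx B
    rw [mem_preimage, hφk, ← hx, ← hTk, hj.injective.mem_set_image]
  refine ⟨⟨?_⟩, ⟨hTm, ?_⟩, fun A B hA hB => ?_⟩
  · rw [happ _ .univ, image_univ]
    exact prob_compl_eq_zero_iff (hφ hj.measurableSet_range) |>.1 hrange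
  · ext A hA
    have hA' : MeasurableSet (φ ⁻¹' (j '' A)) := hφ (hj.measurableSet_image.2 hA)
    rw [Measure.map_apply hTm hA, happ _ (hTm hA), happ _ hA,
      ← hσ.measure_preimage hA'.nullMeasurableSet]
    refine measure_congr ?_
    filter_upwards [hrange] with ω ⟨x, hx⟩
    refine propext ((hmem 0 ω x hx (T ⁻¹' A)).symm.trans ?_)
    exact hmem 1 ω x hx A
  · rw [happ _ hA, happ _ hB]
    refine (hmix _ _ (hφ (hj.measurableSet_image.2 hA))
      (hφ (hj.measurableSet_image.2 hB))).congr fun k => ?_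
    rw [happ _ (hA.inter ((hTm.iterate k) hB))]
    refine measure_congr ?_
    filter_upwards [hrange] with ω ⟨x, hx⟩
    refine propext (Iff.trans ?_ (hmem 0 ω x hx (A ∩ T^[k] ⁻¹' B)))
    exact and_congr (hmem 0 ω x hx A).symm (hmem k ω x hx B).symm

/-- The case where the invariant metric comes from a (possibly inhomogeneous) norm. The measure is
the law of the random series `∑ d (ω n) • v n • e n`, where `d` enumerates a dense set of scalars,
`v` is the scaling for which the shift sends `v n • e n` to `v (n - 1) • e (n - 1)`, and the
coordinates of `ω` are independent with a common law that decays fast enough for the series to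
converge almost surely. -/
theorem exists_stronglyMixing_measure_of_dense_periodicPts_shift {𝕜 X : Type*} [RCLike 𝕜]
    [NormedAddCommGroup X] [CompleteSpace X] [Module 𝕜 X] [ContinuousSMul 𝕜 X]
    [MeasurableSpace X] [BorelSpace X]
    (j : X →L[𝕜] (ℤ → 𝕜)) (hj : Function.Injective j)
    (e : ℤ → X) (he : ∀ n, j (e n) = Pi.single n 1) (hbasis : IsUnconditionalBasis 𝕜 e)
    (T : X → X) {w : ℤ → 𝕜} (hw : ∀ n, w n ≠ 0) (hT : ∀ x, j (T x) = bilateralShift w (j x))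
    (hper : Dense (Function.periodicPts T)) :
    ∃ μ : Measure X, IsProbabilityMeasure μ ∧ MeasurePreserving T μ μ ∧
      IsStronglyMixing T μ ∧ HasFullSupport μ := by
  have := separableSpace_of_isUnconditionalBasis hbasis
  have : SecondCountableTopology X := UniformSpace.secondCountable_of_separable X
  -- by the Lusin-Souslin theorem, Borel subsets of `X` can be read off in coordinates
  have hjm : MeasurableEmbedding j := j.continuous.measurableEmbedding hj
  set v := shiftScaling w
  have hv0 : ∀ n, v n ≠ 0 := shiftScaling_ne_zero hw
  set d : ℕ → 𝕜 := TopologicalSpace.denseSeq 𝕜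
  have hd : DenseRange d := TopologicalSpace.denseRange_denseSeq 𝕜
  set g : ℕ → ℤ → X := fun k n => (d k * v n) • e n
  have hg : ∀ k, Summable (g k) := fun k =>
    ((summable_shiftScaling_smul he hbasis hw hT hper).const_smul (d k)).congr fun n => by
      rw [smul_smul]
  choose G hG using fun k => summable_iff_vanishing_norm.1 (hg k) ((1 / 2) ^ k) (by positivity)
  obtain ⟨p, hp0, hp⟩ := exists_pmf_tsum_mul_ne_top fun k => (G k).card
  set P := Measure.infinitePi fun _ : ℤ => p.toMeasure
  set φ : (ℤ → ℕ) → ℤ → 𝕜 := fun ω n => d (ω n) * v n with hφdef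
  have hφ : Measurable φ := measurable_pi_lambda _ fun n =>
    ((measurable_from_top (f := fun k => d k * v n)).comp (measurable_pi_apply n))
  have hSm : Measurable (bilateralShift w) := measurable_pi_lambda _ fun n =>
    (measurable_pi_apply (n + 1)).const_mul _
  have hφσ : ∀ ω, φ (twoSidedShift ω) = bilateralShift w (φ ω) := fun ω => by
    funext n
    simp only [hφdef, twoSidedShift, bilateralShift]
    rw [mul_left_comm, mul_shiftScaling_succ hw]
  have hz : ∀ ω, {n | n ∈ G (ω n)}.Finite → ∃ z, HasSum (fun n => g (ω n) n) z ∧ j z = φ ω := by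
    intro ω hω
    obtain ⟨z, hz⟩ := summable_selection hg hG hω
    exact ⟨z, hz, coordinates_eq_of_hasSum he hz⟩
  have hrange : ∀ᵐ ω ∂P, φ ω ∈ range j := by
    filter_upwards [ae_finite_mem_selection hp] with ω hω
    obtain ⟨z, -, hz⟩ := hz ω hω
    exact ⟨z, hz⟩
  obtain ⟨h1, h2, h3⟩ := IsStronglyMixing.comap_map (measurePreserving_twoSidedShift _)
    (isStronglyMixing_twoSidedShift p.toMeasure) hφ hSm hφσ hjm hT hrange
  refine ⟨_, h1, h2, h3, fun U hU ⟨x, hxU⟩ => ?_⟩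
  rw [hjm.comap_apply, Measure.map_apply hφ (hjm.measurableSet_image.2 hU.measurableSet)]
  -- a finitely supported vector in `U`, and a ball around it
  obtain ⟨F₀, hF₀⟩ := (((hasSum_coordinates he hbasis x).eventually_mem (hU.mem_nhds hxU))).exists
  obtain ⟨ε, hε, hball⟩ := Metric.isOpen_iff.1 hU _ hF₀
  obtain ⟨H, hH⟩ := exists_finset_norm_sum_selection_le hg hG (half_pos hε)
  obtain ⟨Q₀, hQ₀⟩ := exists_finset_measure_selection_pos hp0 hp
  set Q := F₀ ∪ H ∪ Q₀
  have hQF : F₀ ⊆ Q := Finset.subset_union_left.trans Finset.subset_union_left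
  have hQH : H ⊆ Q := Finset.subset_union_right.trans Finset.subset_union_left
  -- values on `Q` for which the partial sum over `Q` is close to that vector
  obtain ⟨c, hc⟩ : ∃ c : ℤ → ℕ,
      ‖∑ n ∈ Q, g (c n) n - ∑ n ∈ F₀, j x n • e n‖ < ε / 2 := by
    have hcont : Continuous fun a : ℤ → 𝕜 => ∑ n ∈ Q, (a n * v n) • e n := by fun_prop
    have hdr : DenseRange fun c : ℤ → ℕ => fun n => d (c n) := DenseRange.piMap fun _ => hd
    have hO : IsOpen {a : ℤ → 𝕜 | ‖∑ n ∈ Q, (a n * v n) • e n - ∑ n ∈ F₀, j x n • e n‖ < ε / 2} :=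
      isOpen_lt (by fun_prop) continuous_const
    refine hdr.exists_mem_open hO ⟨fun n => if n ∈ F₀ then j x n / v n else 0, ?_⟩
    have : ∑ n ∈ Q, ((if n ∈ F₀ then j x n / v n else 0) * v n) • e n =
        ∑ n ∈ F₀, j x n • e n := by
      rw [← Finset.sum_subset hQF fun n _ hn => by simp [hn]]
      exact Finset.sum_congr rfl fun n hn => by simp [hn, hv0]
    rw [mem_ofPred_eq, this, sub_self, norm_zero]
    exact half_pos hε
  refine (hQ₀ Q Finset.subset_union_right c).trans_le (measure_mono ?_)
  rintro ω ⟨hωQ, hω⟩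
  obtain ⟨z, hzsum, hjz⟩ := hz ω
    (Q.finite_toSet.subset fun n hn => by_contra fun hnQ => hω n hnQ hn)
  refine ⟨z, hball ?_, hjz⟩
  have htail := norm_sub_sum_le_of_hasSum hzsum (Q := Q) fun F hF =>
    (hH ω F (Finset.disjoint_of_subset_right hQH hF) fun n hn =>
      hω n (Finset.disjoint_left.1 hF hn)).le
  rw [Finset.sum_congr rfl fun n hn => by rw [hωQ n hn]] at htail
  rw [mem_ball_iff_norm]
  calc _ = ‖(z - ∑ n ∈ Q, g (c n) n) + (∑ n ∈ Q, g (c n) n - ∑ n ∈ F₀, j x n • e n)‖ := by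
        rw [sub_add_sub_cancel]
    _ < ε := (norm_add_le _ _).trans_lt (by linarith)

theorem mainTheorem3 {𝕜 X : Type*} [RCLike 𝕜] [AddCommGroup X] [Module 𝕜 X] [TopologicalSpace X]
    [MeasurableSpace X] [BorelSpace X] (hX : IsFSpace 𝕜 X)
    (j : X →L[𝕜] (ℤ → 𝕜)) (hj : Function.Injective j)
    (e : ℤ → X) (he : ∀ n, j (e n) = Pi.single n 1) (hbasis : IsUnconditionalBasis 𝕜 e)
    (T : X → X) (hT : IsBilateralWeightedShift j T) (hchaos : IsChaotic T) :
    ∃ μ : Measure X, IsProbabilityMeasure μ ∧ MeasurePreserving T μ μ ∧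
      IsStronglyMixing T μ ∧ HasFullSupport μ := by
  have := hX.continuousSMul
  obtain ⟨m, rfl, hcomplete, hinv⟩ := hX.exists_metric
  -- the invariant metric makes `X` a normed group (the norm need not be homogeneous)
  let : NormedAddCommGroup X :=
    { ‹AddCommGroup X›, m with
      norm := fun x => m.dist x 0
      dist_eq := fun x y => by
        rw [← hinv x y (-x), add_neg_cancel, add_comm y, m.dist_comm] }
  obtain ⟨w, hw, hTw⟩ := hT
  exact exists_stronglyMixing_measure_of_dense_periodicPts_shift j hj e he hbasis T hw hTw hchaos.2
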